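/- **Setting.** A directed graph with hyperedges (HEDG) is a triple $G=(V,E,H)$ with $V$ a finite set, $E\subseteq V\times V$ a set of directed edges (cycles and self-loops allowed) and $H$ a simplicial complex over $V$: a set of subsets of $V$ that contains all singletons and is closed under taking subsets. $\tilde H$ is the set of inclusion-maximal elements of $H$. Write $\mathrm{Pa}(A)$ for the set of $v$ with an edge $v\to w\in E$, $w\in A$; $\mathrm{Anc}(A)$, $\mathrm{Desc}(A)$ for the sets of nodes from, respectively to, which there is a directed path (possibly of length $0$) to, respectively from, a node of $A$; and $\mathrm{Sc}(v)=\mathrm{Anc}(v)\cap\mathrm{Desc}(v)$. A path is a sequence $v_1,\dots,v_n$, $n\ge1$, of nodes (repetitions allowed), in which consecutive nodes are joined by a chosen edge $v_i\to v_{i+1}\in E$, $v_i\leftarrow v_{i+1}$ (that is, $v_{i+1}\to v_i\in E$), or $v_i\leftrightarrow v_{i+1}$ (that is, $v_i\ne v_{i+1}$ and $\{v_i,v_{i+1}\}\in H$). *d-separation.* A path is blocked by $Z\subseteq V$ if $v_1\in Z$ or $v_n\in Z$, or some inner $v_i\notin\mathrm{Anc}(Z)$ is a collider (both adjacent edges have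 an arrowhead at $v_i$), or some inner $v_i\in Z$ is a non-collider. $X\perp^d_G Y\mid Z$ means that every path between a node of $X$ and a node of $Y$ is blocked by $Z$. *σ-separation.* Partition a path into its segments, the maximal blocks of consecutive nodes lying in one strongly connected component. The path is σ-blocked by $Z$ if $v_1\in Z$ or $v_n\in Z$, or some segment has an outgoing directed edge in the path to a neighbouring segment and the endnode of the segment at which this edge starts is in $Z$, or for some inner segment $\tau$ both adjacent edges have an arrowhead towards $\tau$ and the strongly connected component containing $\tau$ is disjoint from $\mathrm{Anc}(Z)$. $X\perp^\sigma_G Y\mid Z$ means that every path between a node of $X$ and a node of $Y$ is σ-blocked by $Z$. *Acyclic augmentation.* $G^{\mathrm{aug}}$ is the directed graph with nodes $V^{\mathrm{aug}}=V\,\dot\cup\,\tilde H$ and edges $E\cup\{F\to v: v\in F\in\tilde H\}$. $G^{\mathrm{acag}}$ has the nodes $V^{\mathrm{aug}}$, no hyperedges with more than one element, and an edge $a\to b$ iff $a\notin\mathrm{Sc}^{G^{\mathrm{aug}}}(b)$ and there is an edge $a\to b'$ in $G^{\mathrm{aug}}$ for some $b'\in\mathrm{Sc}^{G^{\mathrm{aug}}}(b)$.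 Let $\mathcal X_v$, $v\in V$, be standard Borel spaces and $\mathbb P_V$ a probability distribution on $\mathcal X_V=\prod_{v\in V}\mathcal X_v$. For a distribution $Q$ on a product space, $X\perp_Q Y\mid Z$ means that the coordinates in $X$ and those in $Y$ are conditionally $Q$-independent given those in $Z$. *csSEP.* $(G,\mathbb P_V)$ satisfies the component-wisely solvable structural equations property if there are a probability space $(\Omega,\mathbb P)$, standard Borel spaces $\mathcal E_F$ and jointly independent random variables $E_F:\Omega\to\mathcal E_F$ ($F\in\tilde H$), and random variables $X_v:\Omega\to\mathcal X_v$ ($v\in V$) with joint law $\mathbb P_V$, such that for every $v\in V$ there are measurable functions $f_v$ and $\tilde g_v$ with, $\mathbb P$-almost surely, $$X_v=f_v\bigl((X_w)_{w\in\mathrm{Pa}(v)},(E_F)_{F\ni v}\bigr),\qquad X_v=\tilde g_v\bigl((X_w)_{w\in \mathrm{Pa}(\mathrm{Sc}(v))\setminus\mathrm{Sc}(v)},(E_F)_{F\cap\mathrm{Sc}(v)\neq\emptyset}\bigr).$$ *smgdGMP.* $(G,\mathbb P_V)$ satisfies the strong marginal general directed global Markov property if there are standard Borel spaces $\mathcal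 E_F$ ($F\in\tilde H$) and a probability distribution $\mathbb P_{V^{\mathrm{aug}}}$ on $\prod_{v\in V}\mathcal X_v\times\prod_{F\in\tilde H}\mathcal E_F$ with marginal $\mathbb P_V$ on $\mathcal X_V$ such that for all $X,Y,Z\subseteq V^{\mathrm{aug}}$: $X\perp^d_{G^{\mathrm{acag}}}Y\mid Z$ implies $X\perp_{\mathbb P_{V^{\mathrm{aug}}}}Y\mid Z$. **Theorem.** For every HEDG $G=(V,E,H)$ and every probability distribution $\mathbb P_V$ on $\mathcal X_V$: 1. If $(G,\mathbb P_V)$ satisfies csSEP, then it satisfies smgdGMP. 2. More concretely, for all random variables $(X_v)_{v\in V}$, $(E_F)_{F\in\tilde H}$ as in the definition of csSEP, their joint law $Q$ has marginal $\mathbb P_V$ on $\mathcal X_V$, and for all $X,Y,Z\subseteq V^{\mathrm{aug}}$: $X\perp^d_{G^{\mathrm{acag}}}Y\mid Z$ implies $X\perp_Q Y\mid Z$. 3. Hence, if $(G,\mathbb P_V)$ satisfies csSEP, then for all $X,Y,Z\subseteq V$: $X\perp^\sigma_G Y\mid Z$ implies $X\perp_{\mathbb P_V}Y\mid Z$. 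-/

import Mathlib

open MeasureTheory ProbabilityTheory

universe u v w

/-- A directed graph with hyperedges on the node set `V`: directed edges (`Adj a b` means `a → b`;
self-loops and cycles are allowed) and a simplicial complex `H` of hyperedges over `V`. -/
structure HEDG (V : Type v) where
  Adj : V → V → Prop
  H : Set (Set V)
  singleton_mem : ∀ a : V, {a} ∈ H
  down_closed : ∀ F ∈ H, ∀ F' ⊆ F, F' ∈ H

namespace HEDG

variable {V : Type v}

section Graph

variable (G : HEDG V)

/-- The parents of the nodes in `A`. -/
def pa (A : Set V) : Set V := {a | ∃ b ∈ A, G.Adj a b}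

/-- The ancestors of the nodes in `A`; every node is an ancestor of itself. -/
def anc (A : Set V) : Set V := {a | ∃ b ∈ A, Relation.ReflTransGen G.Adj a b}

/-- The descendents of the nodes in `A`; every node is a descendent of itself. -/
def desc (A : Set V) : Set V := {b | ∃ a ∈ A, Relation.ReflTransGen G.Adj a b}

/-- The strongly connected component of `a`. -/
def sc (a : V) : Set V := G.anc {a} ∩ G.desc {a}

/-- The inclusion-maximal hyperedges. -/
abbrev MaxH : Type v := {F : Set V // Maximal (· ∈ G.H) F}

/-- The maximal hyperedges that meet `A`. -/
abbrev MaxHAt (A : Set V) : Type v := {F : G.MaxH // ((F : Set V) ∩ A).Nonempty}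

/-- The nodes of the augmentation: those of `G`, and one node for every maximal hyperedge. -/
abbrev AugNode : Type v := V ⊕ G.MaxH

end Graph

/-- The trivial simplicial complex: only sets with at most one element. -/
def trivialH (V : Type v) : Set (Set V) := {F | F.Subsingleton}

/-- The augmentation: every maximal hyperedge `F` becomes a node with edges `F → b` for `b ∈ F`. -/
def aug (G : HEDG V) : HEDG G.AugNode where
  Adj
    | .inl a, .inl b => G.Adj a b
    | .inr F, .inl b => b ∈ (F : Set V)
    | _, .inr _ => False
  H := trivialH _
  singleton_mem _ := Set.subsingleton_singleton
  down_closed _ hF _ h := hF.anti h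

/-- The acyclification: `a → b` iff `a ∉ Sc(b)` and `a → b'` for some `b' ∈ Sc(b)`;
hyperedges are enlarged by the strongly connected components of their nodes. -/
def acy (G : HEDG V) : HEDG V where
  Adj a b := a ∉ G.sc b ∧ ∃ b' ∈ G.sc b, G.Adj a b'
  H := {F' | ∃ F ∈ G.H, F' ⊆ ⋃ a ∈ F, G.sc a}
  singleton_mem a := ⟨{a}, G.singleton_mem a, by
    simp [sc, anc, desc, Relation.ReflTransGen.refl]⟩
  down_closed := fun _ ⟨F, hF, hsub⟩ _ h => ⟨F, hF, h.trans hsub⟩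

/-- The acyclic augmentation: the directed edges of the acyclification of the augmentation,
with the trivial hyperedges only. -/
def acag (G : HEDG V) : HEDG G.AugNode where
  Adj := G.aug.acy.Adj
  H := trivialH _
  singleton_mem _ := Set.subsingleton_singleton
  down_closed _ hF _ h := hF.anti h

/-- The orientation of an edge between two consecutive nodes `a`, `b` of a path:
`a → b`, `a ← b` or `a ↔ b`. -/
inductive EdgeKind where
  | right
  | left
  | bi

namespace EdgeKind

/-- The edge has an arrowhead at its right end. -/
def HeadRight : EdgeKind → Prop
  | right => True
  | left => False
  | bi => True

/-- The edge has an arrowhead at its left end. -/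
def HeadLeft : EdgeKind → Prop
  | right => False
  | left => True
  | bi => True

end EdgeKind

section Separation

variable (G : HEDG V)

/-- `G` has an edge of the given kind between `a` and `b`. -/
def IsEdge : EdgeKind → V → V → Prop
  | .right, a, b => G.Adj a b
  | .left, a, b => G.Adj b a
  | .bi, a, b => a ≠ b ∧ {a, b} ∈ G.H

/-- A path (repeated nodes allowed) with nodes `node 0, …, node length` and edges
`edge i` between `node i` and `node (i + 1)` for `i < length`. Other values are irrelevant. -/
structure Path where
  length : ℕ
  node : ℕ → V
  edge : ℕ → EdgeKind
  isEdge : ∀ i < length, G.IsEdge (edge i) (node i) (node (i + 1))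

variable {G}

/-- The `i`-th edge points towards `node (i + 1)` and the `k`-th edge towards `node k`. -/
def Path.Collider (p : G.Path) (i k : ℕ) : Prop :=
  (p.edge i).HeadRight ∧ (p.edge k).HeadLeft

/-- The path is blocked by `Z` in the sense of d-separation. -/
def Path.DBlocked (p : G.Path) (Z : Set V) : Prop :=
  p.node 0 ∈ Z ∨ p.node p.length ∈ Z ∨
  ∃ i, i + 1 < p.length ∧
    ((p.Collider i (i + 1) ∧ p.node (i + 1) ∉ G.anc Z) ∨
      (¬ p.Collider i (i + 1) ∧ p.node (i + 1) ∈ Z))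

/-- The nodes `node i, …, node k` form a segment with a neighbour on either side in the path:
they are a maximal block of consecutive nodes in one strongly connected component. -/
def Path.IsInnerSegment (p : G.Path) (i k : ℕ) : Prop :=
  0 < i ∧ i ≤ k ∧ k < p.length ∧ (∀ j, i ≤ j → j ≤ k → p.node j ∈ G.sc (p.node i)) ∧
    p.node (i - 1) ∉ G.sc (p.node i) ∧ p.node (k + 1) ∉ G.sc (p.node i)

/-- The path is blocked by `Z` in the sense of σ-separation (segment version): an endnode is
in `Z`, or a segment has an outgoing directed edge and its corresponding endnode lies in `Z`, or
a segment has arrowheads towards it on both sides and its strongly connected component contains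
no ancestor of `Z`. -/
def Path.SigmaBlocked (p : G.Path) (Z : Set V) : Prop :=
  p.node 0 ∈ Z ∨ p.node p.length ∈ Z ∨
  (∃ i < p.length, p.node (i + 1) ∉ G.sc (p.node i) ∧
    ((p.edge i = .right ∧ p.node i ∈ Z) ∨ (p.edge i = .left ∧ p.node (i + 1) ∈ Z))) ∨
  ∃ i k, p.IsInnerSegment i k ∧ p.Collider (i - 1) k ∧ G.sc (p.node i) ∩ G.anc Z = ∅

variable (G)

/-- `X` is d-separated from `Y` given `Z`. -/
def DSep (X Y Z : Set V) : Prop :=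
  ∀ p : G.Path, p.node 0 ∈ X → p.node p.length ∈ Y → p.DBlocked Z

/-- `X` is σ-separated from `Y` given `Z`. -/
def SigmaSep (X Y Z : Set V) : Prop :=
  ∀ p : G.Path, p.node 0 ∈ X → p.node p.length ∈ Y → p.SigmaBlocked Z

end Separation

section Markov

variable {W : Type v} {𝒳 : W → Type u} [∀ a, MeasurableSpace (𝒳 a)]

/-- The canonical projection of the product space to the coordinates in `A`. -/
def coord (A : Set W) (x : ∀ a, 𝒳 a) : ∀ a : A, 𝒳 a := fun a => x a

theorem measurable_coord (A : Set W) : Measurable (coord (𝒳 := 𝒳) A) :=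
  measurable_pi_lambda _ fun _ => measurable_pi_apply _

variable [Finite W] [∀ a, StandardBorelSpace (𝒳 a)]

/-- Under the distribution `P` on the product space, the coordinates in `X` are conditionally
independent of the coordinates in `Y` given the coordinates in `Z`. -/
def CoordCondIndep (P : Measure (∀ a, 𝒳 a)) [IsFiniteMeasure P] (X Y Z : Set W) : Prop :=
  CondIndepFun (MeasurableSpace.comap (coord Z) inferInstance)
    (measurable_coord Z).comap_le (coord X) (coord Y) P

/-- The directed global Markov property (based on d-separation). -/
def DGMP (G : HEDG W) (P : Measure (∀ a, 𝒳 a)) [IsFiniteMeasure P] : Prop :=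
  ∀ X Y Z : Set W, G.DSep X Y Z → CoordCondIndep P X Y Z

/-- The general directed global Markov property (based on σ-separation). -/
def GdGMP (G : HEDG W) (P : Measure (∀ a, 𝒳 a)) [IsFiniteMeasure P] : Prop :=
  ∀ X Y Z : Set W, G.SigmaSep X Y Z → CoordCondIndep P X Y Z

end Markov

section Augmented

variable {G : HEDG V}

/-- The family of spaces attached to the nodes of the augmentation. -/
def AugSpace (𝒳 : V → Type u) (ℰ : G.MaxH → Type u) : G.AugNode → Type u
  | .inl a => 𝒳 a
  | .inr F => ℰ F

variable {𝒳 : V → Type u} {ℰ : G.MaxH → Type u}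

instance [∀ a, MeasurableSpace (𝒳 a)] [∀ F, MeasurableSpace (ℰ F)] (b : G.AugNode) :
    MeasurableSpace (AugSpace 𝒳 ℰ b) :=
  match b with
  | .inl a => inferInstanceAs (MeasurableSpace (𝒳 a))
  | .inr F => inferInstanceAs (MeasurableSpace (ℰ F))

instance [∀ a, MeasurableSpace (𝒳 a)] [∀ F, MeasurableSpace (ℰ F)]
    [∀ a, StandardBorelSpace (𝒳 a)] [∀ F, StandardBorelSpace (ℰ F)] (b : G.AugNode) :
    StandardBorelSpace (AugSpace 𝒳 ℰ b) :=
  match b with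
  | .inl a => inferInstanceAs (StandardBorelSpace (𝒳 a))
  | .inr F => inferInstanceAs (StandardBorelSpace (ℰ F))

/-- The joint random vector of the observed variables and the error terms. -/
def jointVar {Ω : Type w} (X : ∀ a, Ω → 𝒳 a) (E : ∀ F, Ω → ℰ F) (ω : Ω) :
    ∀ b : G.AugNode, AugSpace 𝒳 ℰ b
  | .inl a => X a ω
  | .inr F => E F ω

/-- The canonical projection from the augmented product space to the observed one. -/
def projV (x : ∀ b : G.AugNode, AugSpace 𝒳 ℰ b) (a : V) : 𝒳 a := x (.inl a)

end Augmented

section StructuralEquations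

variable (G : HEDG V) {𝒳 : V → Type u} [∀ a, MeasurableSpace (𝒳 a)]

/-- The observed variables `X` and error terms `E` on the probability space `(Ω, Pr)` satisfy
structural equations along `G` and induce the distribution `P`. -/
structure IsSEP (P : Measure (∀ a, 𝒳 a)) {Ω : Type w} [MeasurableSpace Ω] (Pr : Measure Ω)
    {ℰ : G.MaxH → Type u} [∀ F, MeasurableSpace (ℰ F)]
    (E : ∀ F, Ω → ℰ F) (X : ∀ a, Ω → 𝒳 a) : Prop where
  measurable_E : ∀ F, Measurable (E F)
  indep_E : iIndepFun E Pr
  measurable_X : ∀ a, Measurable (X a)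
  structural : ∀ a, ∃ f : (∀ b : G.pa {a}, 𝒳 b) × (∀ F : G.MaxHAt {a}, ℰ F) → 𝒳 a,
    Measurable f ∧ ∀ᵐ ω ∂Pr, X a ω = f (fun b => X b ω, fun F => E F ω)
  law : Pr.map (fun ω a => X a ω) = P

/-- In addition, every variable is a measurable function of the variables and error terms
pointing into its strongly connected component from outside. -/
structure IsCsSEP (P : Measure (∀ a, 𝒳 a)) {Ω : Type w} [MeasurableSpace Ω] (Pr : Measure Ω)
    {ℰ : G.MaxH → Type u} [∀ F, MeasurableSpace (ℰ F)]
    (E : ∀ F, Ω → ℰ F) (X : ∀ a, Ω → 𝒳 a) : Prop extends IsSEP G P Pr E X where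
  component : ∀ a, ∃ g : (∀ b : (G.pa (G.sc a) \ G.sc a : Set V), 𝒳 b) ×
      (∀ F : G.MaxHAt (G.sc a), ℰ F) → 𝒳 a,
    Measurable g ∧ ∀ᵐ ω ∂Pr, X a ω = g (fun b => X b ω, fun F => E F ω)

/-- The component-wisely solvable structural equations property. -/
def CsSEP (P : Measure (∀ a, 𝒳 a)) : Prop :=
  ∃ (Ω : Type w) (_ : MeasurableSpace Ω) (Pr : Measure Ω) (_ : IsProbabilityMeasure Pr)
    (ℰ : G.MaxH → Type u) (_ : ∀ F, MeasurableSpace (ℰ F)) (_ : ∀ F, StandardBorelSpace (ℰ F))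
    (E : ∀ F, Ω → ℰ F) (X : ∀ a, Ω → 𝒳 a), IsCsSEP G P Pr E X

/-- The strong marginal general directed global Markov property. -/
def SmgdGMP [Finite V] [∀ a, StandardBorelSpace (𝒳 a)] (P : Measure (∀ a, 𝒳 a)) : Prop :=
  ∃ (ℰ : G.MaxH → Type u) (_ : ∀ F, MeasurableSpace (ℰ F)) (_ : ∀ F, StandardBorelSpace (ℰ F))
    (Q : Measure (∀ b : G.AugNode, AugSpace 𝒳 ℰ b)) (_ : IsProbabilityMeasure Q),
    Q.map projV = P ∧ DGMP G.acag Q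

end StructuralEquations

end HEDG

/-! In the acyclic augmentation, the parents of an observed node `v` are exactly the arguments of
the component-wise solution for `v`: the nodes of Pa(Sc(v)) \ Sc(v) and the maximal hyperedges
meeting Sc(v). Under csSEP each `X v` is therefore almost surely a function of its parents there,
hence conditionally independent of everything given them. The error nodes have no parents and are
jointly independent. This is a local Markov property (`IsCsSEP.coordCondIndep_inl`,
`indep_coordAlg_inr`).

The global property follows from the semigraphoid rules alone, by induction on ancestral sets with a
sink removed at each step (`Semigraphoid.of_dClosed`). The rules are checked on conditional
probabilities: `CondProbEq` says that enlarging the conditioning σ-algebra does not change them. All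
rules except symmetry are then short computations, and symmetry is that of `CondIndep`.

For σ-separation, an open walk between observed nodes of the augmentation, given observed nodes, is
unfolded into a σ-open path of the original graph (`SOpenAt.of_dOpen`). So σ-separation implies
d-separation in the augmentation, and the resulting independence passes to the marginal on the
observed coordinates (`CoordCondIndep.map_projV`). -/

namespace ProbabilityTheory

/-! ### Conditional independence through conditional probabilities -/

open MeasureTheory

variable {Ω : Type*} {m' m₁ m₂ m₃ : MeasurableSpace Ω} {mΩ : MeasurableSpace Ω}
  {μ : Measure Ω}

/-- Every event of `m₁` has the same conditional probability given `m'` and given `m₂ ⊔ m'`. -/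
def CondProbEq (m₁ m₂ m' : MeasurableSpace Ω) {mΩ : MeasurableSpace Ω} (μ : Measure Ω) : Prop :=
  ∀ t, MeasurableSet[m₁] t → μ⟦t | m₂ ⊔ m'⟧ =ᵐ[μ] μ⟦t | m'⟧

theorem integrable_indicator_const_one [IsFiniteMeasure μ] {t : Set Ω} (ht : MeasurableSet t) :
    Integrable (t.indicator fun _ => (1 : ℝ)) μ :=
  (integrable_const 1).indicator ht

theorem condExp_inter_indicator [IsFiniteMeasure μ] {s t : Set Ω}
    (hs : MeasurableSet s) (ht : MeasurableSet[m'] t) :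
    μ⟦s ∩ t | m'⟧ =ᵐ[μ] t.indicator (μ⟦s | m'⟧) := by
  rw [Set.inter_comm, ← Set.indicator_indicator]
  exact condExp_indicator (integrable_indicator_const_one hs) ht

/-- Tower property through `m₂ ⊔ m'`: the event of `m₂` is pulled out first, and then the
`m'`-measurable conditional probability that remains. -/
theorem CondProbEq.condIndep [StandardBorelSpace Ω] [IsFiniteMeasure μ] (hm' : m' ≤ mΩ)
    (h₁ : m₁ ≤ mΩ) (h₂ : m₂ ≤ mΩ) (h : CondProbEq m₁ m₂ m' μ) : CondIndep m' m₁ m₂ hm' μ := by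
  rw [condIndep_iff _ _ _ hm' h₁ h₂]
  intro t₁ t₂ ht₁ ht₂
  have hsup : m₂ ⊔ m' ≤ mΩ := sup_le h₂ hm'
  have hI : Integrable (t₂.indicator fun _ => (1 : ℝ)) μ :=
    integrable_indicator_const_one (h₂ _ ht₂)
  have hprod : t₂.indicator (μ⟦t₁ | m'⟧) = μ⟦t₁ | m'⟧ * t₂.indicator fun _ => (1 : ℝ) := by
    ext ω
    by_cases hω : ω ∈ t₂ <;> simp [hω]
  calc μ⟦t₁ ∩ t₂ | m'⟧
      =ᵐ[μ] μ[μ⟦t₁ ∩ t₂ | m₂ ⊔ m'⟧ | m'] := (condExp_condExp_of_le le_sup_right hsup).symm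
    _ =ᵐ[μ] μ[t₂.indicator (μ⟦t₁ | m'⟧) | m'] := by
        refine condExp_congr_ae ?_
        refine (condExp_inter_indicator (h₁ _ ht₁)
          ((le_sup_left : m₂ ≤ m₂ ⊔ m') _ ht₂)).trans ?_
        filter_upwards [h t₁ ht₁] with ω hω
        by_cases hω₂ : ω ∈ t₂ <;> simp [hω₂, hω]
    _ =ᵐ[μ] μ⟦t₁ | m'⟧ * μ⟦t₂ | m'⟧ := by
        rw [hprod]
        refine condExp_mul_of_stronglyMeasurable_left stronglyMeasurable_condExp ?_ hI
        rw [← hprod]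
        exact integrable_condExp.indicator (h₂ _ ht₂)

theorem isPiSystem_image2_inter (m₁ m₂ : MeasurableSpace Ω) :
    IsPiSystem (Set.image2 (· ∩ ·) {s | MeasurableSet[m₁] s} {s | MeasurableSet[m₂] s}) := by
  rintro _ ⟨a, ha, b, hb, rfl⟩ _ ⟨c, hc, d, hd, rfl⟩ -
  exact ⟨a ∩ c, MeasurableSet.inter ha hc, b ∩ d, MeasurableSet.inter hb hd,
    Set.inter_inter_inter_comm _ _ _ _⟩

theorem sup_eq_generateFrom_image2_inter (m₁ m₂ : MeasurableSpace Ω) :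
    m₁ ⊔ m₂ = MeasurableSpace.generateFrom
      (Set.image2 (· ∩ ·) {s | MeasurableSet[m₁] s} {s | MeasurableSet[m₂] s}) := by
  refine le_antisymm (sup_le ?_ ?_) (MeasurableSpace.generateFrom_le ?_)
  · exact fun s hs => MeasurableSpace.measurableSet_generateFrom
      ⟨s, hs, Set.univ, MeasurableSet.univ, Set.inter_univ s⟩
  · exact fun s hs => MeasurableSpace.measurableSet_generateFrom
      ⟨Set.univ, MeasurableSet.univ, s, hs, Set.univ_inter s⟩
  · rintro _ ⟨a, ha, b, hb, rfl⟩
    exact MeasurableSet.inter ((le_sup_left : m₁ ≤ m₁ ⊔ m₂) _ ha)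
      ((le_sup_right : m₂ ≤ m₁ ⊔ m₂) _ hb)

/-- The candidate `μ⟦t | m'⟧` has the correct integrals over intersections of an `m₂`-event with an
`m'`-event, by the product formula. These form a π-system generating `m₂ ⊔ m'`; complements are
handled by equality of the total integrals. -/
theorem CondIndep.condProbEq [StandardBorelSpace Ω] [IsFiniteMeasure μ] {hm' : m' ≤ mΩ}
    (h₁ : m₁ ≤ mΩ) (h₂ : m₂ ≤ mΩ) (h : CondIndep m' m₁ m₂ hm' μ) : CondProbEq m₁ m₂ m' μ := by
  rw [condIndep_iff _ _ _ hm' h₁ h₂] at h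
  intro t ht
  have hsup : m₂ ⊔ m' ≤ mΩ := sup_le h₂ hm'
  have hIt : Integrable (t.indicator fun _ => (1 : ℝ)) μ :=
    integrable_indicator_const_one (h₁ _ ht)
  refine (ae_eq_condExp_of_forall_setIntegral_eq hsup hIt
    (fun _ _ _ => integrable_condExp.integrableOn) ?_
    ((stronglyMeasurable_condExp (m := m')).mono
      (le_sup_right : m' ≤ m₂ ⊔ m')).aestronglyMeasurable).symm
  intro s hs _
  induction s, hs using MeasurableSpace.induction_on_inter
    (sup_eq_generateFrom_image2_inter m₂ m') (isPiSystem_image2_inter m₂ m') with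
  | empty => simp
  | basic s hs =>
    obtain ⟨a, ha, b, hb, rfl⟩ := hs
    have haΩ := h₂ _ ha
    have hbΩ := hm' _ hb
    have hprod : a.indicator (μ⟦t | m'⟧) = μ⟦t | m'⟧ * a.indicator fun _ => (1 : ℝ) := by
      ext ω
      by_cases hω : ω ∈ a <;> simp [hω]
    have hint : Integrable (a.indicator (μ⟦t | m'⟧)) μ := integrable_condExp.indicator haΩ
    calc ∫ x in a ∩ b, (μ⟦t | m'⟧) x ∂μ
        = ∫ x in b, a.indicator (μ⟦t | m'⟧) x ∂μ := by
          rw [Set.inter_comm, setIntegral_indicator haΩ]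
      _ = ∫ x in b, (μ[a.indicator (μ⟦t | m'⟧) | m']) x ∂μ :=
          (setIntegral_condExp hm' hint hb).symm
      _ = ∫ x in b, (μ⟦t ∩ a | m'⟧) x ∂μ := by
          refine setIntegral_congr_ae hbΩ ?_
          have h1 : μ[a.indicator (μ⟦t | m'⟧) | m'] =ᵐ[μ] μ⟦t | m'⟧ * μ⟦a | m'⟧ := by
            rw [hprod] at hint ⊢
            exact condExp_mul_of_stronglyMeasurable_left stronglyMeasurable_condExp hint
              (integrable_indicator_const_one haΩ)
          filter_upwards [h1, h t a ht ha] with ω hω hω' _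
          rw [hω, hω']
      _ = ∫ x in b, (t ∩ a).indicator (fun _ => (1 : ℝ)) x ∂μ :=
          setIntegral_condExp hm' (integrable_indicator_const_one ((h₁ _ ht).inter haΩ)) hb
      _ = ∫ x in a ∩ b, t.indicator (fun _ => (1 : ℝ)) x ∂μ := by
          rw [Set.inter_comm a b, ← setIntegral_indicator haΩ, Set.indicator_indicator,
            Set.inter_comm a t]
  | compl s hs ih =>
    have hsΩ := hsup _ hs
    have e1 := integral_add_compl hsΩ (integrable_condExp (f := t.indicator fun _ => (1 : ℝ))
      (m := m') (μ := μ))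
    have e2 := integral_add_compl hsΩ hIt
    have e3 := integral_condExp hm' (μ := μ) (f := t.indicator fun _ => (1 : ℝ))
    have ih := ih (measure_lt_top _ _)
    linarith
  | iUnion f hd hf ih =>
    rw [integral_iUnion (fun i => hsup _ (hf i)) hd integrable_condExp.integrableOn,
      integral_iUnion (fun i => hsup _ (hf i)) hd hIt.integrableOn]
    exact tsum_congr fun i => ih i (measure_lt_top _ _)

theorem condIndep_iff_condProbEq [StandardBorelSpace Ω] [IsFiniteMeasure μ] {hm' : m' ≤ mΩ}
    (h₁ : m₁ ≤ mΩ) (h₂ : m₂ ≤ mΩ) : CondIndep m' m₁ m₂ hm' μ ↔ CondProbEq m₁ m₂ m' μ :=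
  ⟨fun h => h.condProbEq h₁ h₂, fun h => h.condIndep hm' h₁ h₂⟩

theorem condProbEq_self (m₁ m' : MeasurableSpace Ω) : CondProbEq m₁ m' m' μ :=
  fun t _ => by rw [sup_idem]

theorem CondProbEq.mono_right [IsFiniteMeasure μ] (hm' : m' ≤ mΩ) (h₂ : m₂ ≤ mΩ)
    (h : CondProbEq m₁ m₂ m' μ) (h32 : m₃ ≤ m₂) : CondProbEq m₁ m₃ m' μ := by
  intro t ht
  have hle : m₃ ⊔ m' ≤ m₂ ⊔ m' := sup_le_sup_right h32 _
  have hsup : m₂ ⊔ m' ≤ mΩ := sup_le h₂ hm'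
  calc μ⟦t | m₃ ⊔ m'⟧ =ᵐ[μ] μ[μ⟦t | m₂ ⊔ m'⟧ | m₃ ⊔ m'] :=
        (condExp_condExp_of_le hle hsup).symm
    _ =ᵐ[μ] μ[μ⟦t | m'⟧ | m₃ ⊔ m'] := condExp_congr_ae (h t ht)
    _ = μ⟦t | m'⟧ := condExp_of_stronglyMeasurable (hle.trans hsup)
        (stronglyMeasurable_condExp.mono le_sup_right) integrable_condExp

/-- Conditioning on `m₂ ⊔ m'` and on `m₃ ⊔ m'` both give `μ⟦t | m'⟧`. -/
theorem CondProbEq.weakUnion [IsFiniteMeasure μ] (hm' : m' ≤ mΩ) (h₂ : m₂ ≤ mΩ)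
    (h : CondProbEq m₁ m₂ m' μ) (h32 : m₃ ≤ m₂) : CondProbEq m₁ m₂ (m' ⊔ m₃) μ := by
  intro t ht
  have e : m₂ ⊔ (m' ⊔ m₃) = m₂ ⊔ m' := by
    rw [← sup_assoc, sup_right_comm, sup_eq_left.2 h32]
  rw [e, sup_comm m' m₃]
  exact (h t ht).trans (h.mono_right hm' h₂ h32 t ht).symm

theorem CondProbEq.contraction (h : CondProbEq m₁ m₂ m' μ)
    (h' : CondProbEq m₁ m₃ (m' ⊔ m₂) μ) : CondProbEq m₁ (m₂ ⊔ m₃) m' μ := by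
  intro t ht
  have e : m₂ ⊔ m₃ ⊔ m' = m₃ ⊔ (m' ⊔ m₂) := by
    rw [sup_comm m₂ m₃, sup_assoc, sup_comm m₂ m']
  rw [e]
  refine (h' t ht).trans ?_
  rw [sup_comm]
  exact h t ht

/-- Events that are almost surely determined by `m'` are conditionally independent of anything. -/
theorem condProbEq_of_ae_eq [IsFiniteMeasure μ] (hm' : m' ≤ mΩ) (h₂ : m₂ ≤ mΩ)
    (h : ∀ t, MeasurableSet[m₁] t → ∃ t', MeasurableSet[m'] t' ∧ t =ᵐ[μ] t') :
    CondProbEq m₁ m₂ m' μ := by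
  intro t ht
  obtain ⟨t', ht', htt'⟩ := h t ht
  have hind : (t.indicator fun _ => (1 : ℝ)) =ᵐ[μ] t'.indicator fun _ => (1 : ℝ) :=
    indicator_ae_eq_of_ae_eq_set htt'
  have hsm : StronglyMeasurable[m'] (t'.indicator fun _ => (1 : ℝ)) :=
    stronglyMeasurable_const.indicator ht'
  have hint : Integrable (t'.indicator fun _ => (1 : ℝ)) μ :=
    integrable_indicator_const_one (hm' _ ht')
  refine (condExp_congr_ae hind).trans (Filter.EventuallyEq.trans ?_ (condExp_congr_ae hind).symm)
  rw [condExp_of_stronglyMeasurable (sup_le h₂ hm') (hsm.mono le_sup_right) hint,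
    condExp_of_stronglyMeasurable hm' hsm hint]

theorem Indep.condProbEq_bot [IsProbabilityMeasure μ] (h₁ : m₁ ≤ mΩ) (h₂ : m₂ ≤ mΩ)
    (h : Indep m₁ m₂ μ) : CondProbEq m₁ m₂ ⊥ μ := by
  intro t ht
  rw [sup_bot_eq, condExp_bot]
  exact condExp_indep_eq h₁ h₂ (stronglyMeasurable_const.indicator ht) h

/-- Conditional probabilities with respect to an image measure. -/
theorem condExp_map_comp {Ω' : Type*} {m mΩ' : MeasurableSpace Ω'} [IsFiniteMeasure μ]
    {φ : Ω → Ω'} (hφ : Measurable φ) (hm : m ≤ mΩ') {t : Set Ω'}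
    (ht : MeasurableSet t) :
    (fun ω => ((μ.map φ)⟦t | m⟧) (φ ω)) =ᵐ[μ] μ⟦φ ⁻¹' t | m.comap φ⟧ := by
  have hmφ : m.comap φ ≤ mΩ := (MeasurableSpace.comap_mono hm).trans hφ.comap_le
  have hint : Integrable ((μ.map φ)⟦t | m⟧) (μ.map φ) := integrable_condExp
  refine ae_eq_condExp_of_forall_setIntegral_eq hmφ
    (integrable_indicator_const_one (hφ ht)) ?_ ?_ ?_
  · exact fun _ _ _ => (hint.comp_measurable hφ).integrableOn
  · rintro _ ⟨s, hs, rfl⟩ -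
    have h1 := setIntegral_condExp hm (integrable_indicator_const_one (μ := μ.map φ) ht) hs
    rw [setIntegral_map (hm _ hs) hint.aestronglyMeasurable hφ.aemeasurable,
      setIntegral_map (hm _ hs)
        (integrable_indicator_const_one (μ := μ.map φ) ht).aestronglyMeasurable
        hφ.aemeasurable] at h1
    exact h1
  · exact (stronglyMeasurable_condExp.comp_measurable
      (comap_measurable φ)).aestronglyMeasurable

theorem CondProbEq.map {Ω' : Type*} {n₁ n₂ n' mΩ' : MeasurableSpace Ω'} [IsFiniteMeasure μ]
    {φ : Ω → Ω'} (hφ : Measurable φ) (hn₁ : n₁ ≤ mΩ')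
    (hn₂ : n₂ ≤ mΩ') (hn' : n' ≤ mΩ')
    (h : CondProbEq (n₁.comap φ) (n₂.comap φ) (n'.comap φ) μ) :
    CondProbEq n₁ n₂ n' (μ.map φ) := by
  intro t ht
  have hsup : n₂ ⊔ n' ≤ mΩ' := sup_le hn₂ hn'
  have h1 := condExp_map_comp (μ := μ) hφ hsup (hn₁ _ ht)
  have h2 := condExp_map_comp (μ := μ) hφ hn' (hn₁ _ ht)
  rw [MeasurableSpace.comap_sup] at h1
  refine (ae_map_iff hφ.aemeasurable (measurableSet_eq_fun
    (stronglyMeasurable_condExp.mono hsup).measurable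
    (stronglyMeasurable_condExp.mono hn').measurable)).2 ?_
  exact (h1.trans (h _ ⟨t, ht, rfl⟩)).trans h2.symm

end ProbabilityTheory

/-! ### Open walks and d-separation -/

namespace HEDG

/-- The nodes from which `r` leads to a node of `Z`. -/
def ancOf {W : Type*} (r : W → W → Prop) (Z : Set W) : Set W :=
  {a | ∃ b ∈ Z, Relation.ReflTransGen r a b}

/-- A walk along the edges of `r` from `x` to the given node, none of whose inner nodes blocks it
given `Z`. The flag records whether the last edge points towards the last node. -/
inductive DOpen {W : Type*} (r : W → W → Prop) (Z : Set W) (x : W) : W → Bool → Prop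
  | start : x ∉ Z → DOpen r Z x x false
  | right {a b : W} {h : Bool} : DOpen r Z x a h → a ∉ Z → r a b → DOpen r Z x b true
  | left {a b : W} {h : Bool} : DOpen r Z x a h → (h = true → a ∈ ancOf r Z) →
      (h = false → a ∉ Z) → r b a → DOpen r Z x b false

/-- No open walk leads from a node of `X` to a node of `Y`. -/
def DClosed {W : Type*} (r : W → W → Prop) (X Y Z : Set W) : Prop :=
  ∀ x ∈ X, ∀ y ∈ Y, ∀ h, DOpen r Z x y h → y ∈ Z

section DOpen

variable {W : Type*} {r r' : W → W → Prop} {X Y Z Z' : Set W} {x y z : W}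

theorem ancOf_mono (hr : ∀ a b, r' a b → r a b) (hZ : Z' ⊆ Z) : ancOf r' Z' ⊆ ancOf r Z :=
  fun _ ⟨b, hb, h⟩ => ⟨b, hZ hb, Relation.ReflTransGen.mono hr _ _ h⟩

theorem subset_ancOf : Z ⊆ ancOf r Z := fun a ha => ⟨a, ha, .refl⟩

theorem DOpen.start_notMem {h : Bool} (hx : DOpen r Z x y h) : x ∉ Z := by
  induction hx <;> assumption

/-- Enlarging the graph and the conditioning set keeps a walk open if no new conditioning node
has an outgoing edge in the smaller graph. -/
theorem DOpen.mono (hr : ∀ a b, r' a b → r a b) (hZ : Z' ⊆ Z)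
    (hout : ∀ a b, r' a b → a ∈ Z → a ∈ Z') (hx : x ∉ Z) {h : Bool} (hxy : DOpen r' Z' x y h) :
    DOpen r Z x y h ∧ (h = false → y ∉ Z' → y ∉ Z) := by
  induction hxy with
  | start _ => exact ⟨.start hx, fun _ _ => hx⟩
  | right _ ha hab ih =>
    exact ⟨.right ih.1 (fun haZ => ha (hout _ _ hab haZ)) (hr _ _ hab), fun h => by simp at h⟩
  | left _ h1 h2 hba ih =>
    exact ⟨.left ih.1 (fun h => ancOf_mono hr hZ (h1 h)) (fun h => ih.2 h (h2 h)) (hr _ _ hba),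
      fun _ hb hbZ => hb (hout _ _ hba hbZ)⟩

/-- An open walk from `x` to `z` and one from `y` to `z` combine if `z` does not block. -/
theorem DOpen.trans_symm {h h' : Bool} (hxz : DOpen r Z x z h) (hyz : DOpen r Z y z h')
    (hcol : h = true → h' = true → z ∈ ancOf r Z)
    (hnon : h = false ∨ h' = false → z ∉ Z) : ∃ h'', DOpen r Z x y h'' := by
  -- The last edge of the second walk is reversed and appended to the first, so the meeting point
  -- moves back towards `y`.
  induction hyz generalizing h with
  | start _ => exact ⟨h, hxz⟩
  | right _ ha hab ih =>
    exact ih (.left hxz (fun h => hcol h rfl) (fun h => hnon (.inl h)) hab)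
      (fun h => by simp at h) (fun _ => ha)
  | left _ h1 h2 hba ih =>
    exact ih (.right hxz (hnon (.inr rfl)) hba) (fun _ => h1) (fun h => h2 (by simpa using h))

theorem DOpen.symm {h : Bool} (hxy : DOpen r Z x y h) (hy : y ∉ Z) : ∃ h', DOpen r Z y x h' :=
  (DOpen.start hy).trans_symm hxy (fun h => by simp at h) (fun _ => hy)

theorem DClosed.symm (hXY : DClosed r X Y Z) : DClosed r Y X Z := by
  intro y hy x hx h hyx
  by_contra hxZ
  obtain ⟨h', hxy⟩ := hyx.symm hxZ
  exact hyx.start_notMem (hXY x hx y hy h' hxy)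

theorem DClosed.mono {X' Y' : Set W} (hXY : DClosed r X Y Z) (hX : X' ⊆ X) (hY : Y' ⊆ Y) :
    DClosed r X' Y' Z := fun x hx y hy => hXY x (hX hx) y (hY hy)

theorem DClosed.restrict (hr : ∀ a b, r' a b → r a b) (hXY : DClosed r X Y Z) :
    DClosed r' X Y Z := fun x hx y hy h hxy =>
  hXY x hx y hy h (DOpen.mono hr subset_rfl (fun _ _ _ => id) hxy.start_notMem hxy).1

end DOpen

/-- The semigraphoid rules for a conditional independence relation on sets of variables. -/
structure Semigraphoid {W : Type*} (CI : Set W → Set W → Set W → Prop) : Prop where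
  refl (X Z) : CI X Z Z
  symm {X Y Z} : CI X Y Z → CI Y X Z
  mono {X Y Y' Z} : CI X Y Z → Y' ⊆ Y → CI X Y' Z
  weakUnion {X Y U Z} : CI X Y Z → U ⊆ Y → CI X Y (Z ∪ U)
  contraction {X Y U Z} : CI X Y Z → CI X U (Z ∪ Y) → CI X (Y ∪ U) Z

/-! ### From the local to the global Markov property -/

namespace Semigraphoid

variable {W : Type*} {CI : Set W → Set W → Set W → Prop} {X Y Z A : Set W} {s : W}

theorem mono' (h : Semigraphoid CI) {X' Y' : Set W} (hc : CI X Y Z) (hX : X' ⊆ X)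
    (hY : Y' ⊆ Y) : CI X' Y' Z := h.symm (h.mono (h.symm (h.mono hc hY)) hX)

theorem union_right (h : Semigraphoid CI) (hc : CI X Y Z) : CI X (Y ∪ Z) Z :=
  h.contraction hc (h.mono (h.refl X (Z ∪ Y)) Set.subset_union_left)

/-- Conditioning variables can be adjoined on either side, by contraction with the trivial
independence from `Z`. -/
theorem of_diff (h : Semigraphoid CI) (hc : CI (X \ Z) (Y \ Z) Z) : CI X Y Z := by
  refine h.mono' (h.symm (h.union_right (h.symm (h.union_right hc)))) ?_ ?_ <;>
    · rw [Set.sdiff_union_self]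
      exact Set.subset_union_left

/-- The edges of `r` inside `A`. -/
def edgesIn (r : W → W → Prop) (A : Set W) (a b : W) : Prop := r a b ∧ a ∈ A ∧ b ∈ A

/-- Adding a sink `s` that is independent of the other variables given its parents. -/
theorem insert_sink (h : Semigraphoid CI) {r : W → W → Prop}
    (hanc : ∀ a b, r a b → b ∈ A → a ∈ A) (hsA : s ∈ A) (hsink : ∀ b ∈ A, ¬ r s b)
    (hloc : CI {s} (A \ {s}) {a | r a s})
    (ih : ∀ X Y Z : Set W, X ⊆ A \ {s} → Y ⊆ A \ {s} → Z ⊆ A \ {s} →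
      DClosed (edgesIn r (A \ {s})) X Y Z → CI X Y Z)
    (hX : X ⊆ A \ {s}) (hY : Y ⊆ A \ {s}) (hZ : Z ⊆ A \ {s})
    (hsep : DClosed (edgesIn r A) X (insert s Y) Z) : CI X (insert s Y) Z := by
  have hsZ : s ∉ Z := fun hs => (hZ hs).2 rfl
  have hpa : {a | r a s} ⊆ A \ {s} := fun a ha =>
    ⟨hanc a s ha hsA, fun e => hsink s hsA (by have e : a = s := e; subst e; exact ha)⟩
  have hres : ∀ a b, edgesIn r (A \ {s}) a b → edgesIn r A a b :=
    fun a b ⟨h1, h2, h3⟩ => ⟨h1, h2.1, h3.1⟩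
  -- An open walk to a parent of `s` outside `Z` would extend to `s`, so these parents are separated
  -- from `X` as well. Once they are adjoined, the local property at `s` and contraction bring in
  -- `s`.
  have h1 : CI X (Y ∪ {a | r a s} \ Z) Z := by
    refine ih _ _ _ hX (Set.union_subset hY (Set.sdiff_subset.trans hpa)) hZ
      (DClosed.restrict hres ?_)
    rintro x hx y (hy | ⟨hy, hyZ⟩) k hxy
    · exact hsep x hx y (.inr hy) k hxy
    · exact absurd (hsep x hx s (.inl rfl) true (.right hxy hyZ ⟨hy, (hpa hy).1, hsA⟩)) hsZ
  have h2 : CI {s} (A \ {s}) ({a | r a s} ∪ (Z ∪ Y)) :=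
    h.weakUnion hloc (Set.union_subset hZ hY)
  have e : {a | r a s} ∪ (Z ∪ Y) = Z ∪ (Y ∪ {a | r a s} \ Z) := by
    ext a
    simp only [Set.mem_union, Set.mem_sdiff]
    tauto
  rw [e] at h2
  refine h.mono (h.contraction h1 (h.symm (h.mono h2 hX))) ?_
  rintro a (rfl | ha)
  · exact .inr rfl
  · exact .inl (.inl ha)

/-- The directed global Markov property follows from the independence of suitable sinks of
ancestral sets from the rest of the set given their parents. -/
theorem of_dClosed [Finite W] (h : Semigraphoid CI) {r : W → W → Prop}
    (hloc : ∀ A : Set W, A.Nonempty → (∀ a b, r a b → b ∈ A → a ∈ A) →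
      ∃ s ∈ A, (∀ b ∈ A, ¬ r s b) ∧ CI {s} (A \ {s}) {a | r a s})
    (hsep : DClosed r X Y Z) : CI X Y Z := by
  suffices key : ∀ A : Set W, (∀ a b, r a b → b ∈ A → a ∈ A) → ∀ X Y Z : Set W, X ⊆ A → Y ⊆ A →
      Z ⊆ A → DClosed (edgesIn r A) X Y Z → CI X Y Z from
    key Set.univ (fun _ _ _ _ => trivial) X Y Z (Set.subset_univ _) (Set.subset_univ _)
      (Set.subset_univ _) (hsep.restrict fun _ _ h => h.1)
  intro A
  induction A using WellFoundedLT.induction with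
  | ind A IH =>
  intro hanc X Y Z hX hY hZ hsep
  rcases A.eq_empty_or_nonempty with rfl | hne
  · rw [Set.subset_empty_iff.1 hX, Set.subset_empty_iff.1 hY, Set.subset_empty_iff.1 hZ]
    exact h.refl _ _
  obtain ⟨s, hsA, hsink, hs⟩ := hloc A hne hanc
  have hlt : A \ {s} < A := ⟨Set.sdiff_subset, fun hle => (hle hsA).2 rfl⟩
  have ih := IH (A \ {s}) hlt fun a b hab hb =>
    ⟨hanc a b hab hb.1, fun e => hsink b hb.1 (by have e : a = s := e; subst e; exact hab)⟩
  have hsub {B : Set W} (hB : B ⊆ A) (hsB : s ∉ B) : B ⊆ A \ {s} :=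
    Set.subset_sdiff_singleton hB hsB
  have insR {X Y Z : Set W} (hX : X ⊆ A) (hY : Y ⊆ A) (hZ : Z ⊆ A) (hsX : s ∉ X)
      (hsZ : s ∉ Z) (hsep : DClosed (edgesIn r A) X (insert s Y) Z) : CI X (insert s Y) Z := by
    have e : insert s (Y \ {s}) = insert s Y := Set.insert_sdiff_singleton
    rw [← e] at hsep ⊢
    exact h.insert_sink hanc hsA hsink hs ih (hsub hX hsX) (hsub (Set.sdiff_subset.trans hY)
      fun h => h.2 rfl) (hsub hZ hsZ) hsep
  by_cases hsZ : s ∈ Z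
  -- A sink in `Z` can only be a collider inside a walk, so dropping it from the conditioning set
  -- opens no walk between `X \ Z` and `Y \ Z`. It is then separated from one of the two sides,
  -- joins the opposite side, and returns to the conditioning set by weak union.
  · refine h.of_diff ?_
    have hZe : Z \ {s} ∪ {s} = Z := by
      rw [Set.sdiff_union_self, Set.union_eq_self_of_subset_right (by simpa using hsZ)]
    have hX' : X \ Z ⊆ A := Set.sdiff_subset.trans hX
    have hY' : Y \ Z ⊆ A := Set.sdiff_subset.trans hY
    have hZ' : Z \ {s} ⊆ A := Set.sdiff_subset.trans hZ
    have hsnZ : s ∉ Z \ {s} := fun h => h.2 rfl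
    have lift {x y : W} {k : Bool} (hx : x ∉ Z) (hxy : DOpen (edgesIn r A) (Z \ {s}) x y k) :
        DOpen (edgesIn r A) Z x y k ∧ (k = false → y ∉ Z \ {s} → y ∉ Z) :=
      DOpen.mono (fun _ _ => id) Set.sdiff_subset
        (fun a b hab haZ => ⟨haZ, fun e => hsink b hab.2.2
          (by have e : a = s := e; subst e; exact hab.1)⟩) hx hxy
    have liftS {x : W} {k : Bool} (hx : x ∉ Z)
        (hxs : DOpen (edgesIn r A) (Z \ {s}) x s k) : DOpen (edgesIn r A) Z x s true := by
      obtain ⟨h1, h2⟩ := lift hx hxs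
      cases k
      · exact absurd hsZ (h2 rfl hsnZ)
      · exact h1
    have hXY : DClosed (edgesIn r A) (X \ Z) (Y \ Z) (Z \ {s}) := fun x hx y hy k hxy =>
      absurd (hsep x hx.1 y hy.1 k (lift hx.2 hxy).1) hy.2
    -- Open walks from both sides to `s` would meet there in a collider belonging to `Z`, giving an
    -- open walk between the two sides.
    have halt : DClosed (edgesIn r A) (X \ Z) {s} (Z \ {s}) ∨
        DClosed (edgesIn r A) (Y \ Z) {s} (Z \ {s}) := by
      by_contra hcon
      simp only [DClosed, not_or, not_forall] at hcon
      obtain ⟨⟨x, hx, _, rfl, k, hxs, -⟩, y, hy, _, rfl, k', hys, -⟩ := hcon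
      obtain ⟨k'', hxy⟩ := (liftS hx.2 hxs).trans_symm (liftS hy.2 hys)
        (fun _ _ => subset_ancOf hsZ) (fun h => by simp at h)
      exact hy.2 (hsep x hx.1 y hy.1 k'' hxy)
    have conclude {X Y : Set W} (hX : X ⊆ A) (hY : Y ⊆ A) (hsX : s ∉ X)
        (hXY : DClosed (edgesIn r A) X Y (Z \ {s})) (hXs : DClosed (edgesIn r A) X {s} (Z \ {s})) :
        CI X Y Z := by
      have h1 : CI X (insert s Y) (Z \ {s}) := by
        refine insR hX hY hZ' hsX hsnZ ?_
        rintro x hx y (rfl | hy)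
        · exact hXs x hx _ rfl
        · exact hXY x hx y hy
      rw [← hZe]
      exact h.mono (h.weakUnion h1 (by simp)) (Set.subset_insert _ _)
    rcases halt with hXs | hYs
    · exact conclude hX' hY' (fun h => h.2 hsZ) hXY hXs
    · exact h.symm (conclude hY' hX' (fun h => h.2 hsZ) hXY.symm hYs)
  · by_cases hsY : s ∈ Y
    -- The walk of length zero is open outside `Z`, so a node of both `X` and `Y` must lie in `Z`.
    · have hsX : s ∉ X := fun hsX => hsZ (hsep s hsX s hsY false (.start hsZ))
      have e : insert s Y = Y := Set.insert_eq_of_mem hsY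
      rw [← e] at hsep ⊢
      exact insR hX hY hZ hsX hsZ hsep
    · by_cases hsX : s ∈ X
      · have e : insert s X = X := Set.insert_eq_of_mem hsX
        rw [← e] at hsep ⊢
        exact h.symm (insR hY hX hZ hsY hsZ hsep.symm)
      · refine ih X Y Z (hsub hX hsX) (hsub hY hsY) (hsub hZ hsZ) (hsep.restrict ?_)
        exact fun a b ⟨h1, h2, h3⟩ => ⟨h1, h2.1, h3.1⟩

end Semigraphoid

end HEDG

/-! ### From open walks to paths, for d-separation and σ-separation -/

namespace HEDG

variable {V : Type v} {G : HEDG V}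

theorem mem_sc {a b : V} :
    b ∈ G.sc a ↔ Relation.ReflTransGen G.Adj b a ∧ Relation.ReflTransGen G.Adj a b := by
  simp [sc, anc, desc]

theorem self_mem_sc (a : V) : a ∈ G.sc a := mem_sc.2 ⟨.refl, .refl⟩

theorem mem_sc_symm {a b : V} (h : b ∈ G.sc a) : a ∈ G.sc b := mem_sc.2 (mem_sc.1 h).symm

theorem mem_sc_trans {a b c : V} (hb : b ∈ G.sc a) (hc : c ∈ G.sc b) : c ∈ G.sc a :=
  mem_sc.2 ⟨(mem_sc.1 hc).1.trans (mem_sc.1 hb).1, (mem_sc.1 hb).2.trans (mem_sc.1 hc).2⟩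

theorem mem_anc_of_mem_sc {Z : Set V} {a b : V} (h : b ∈ G.sc a) (ha : a ∈ G.anc Z) :
    b ∈ G.anc Z :=
  let ⟨c, hc, hac⟩ := ha
  ⟨c, hc, (mem_sc.1 h).1.trans hac⟩

namespace Path

/-- Appends an edge to a path. -/
def snoc (p : G.Path) (k : EdgeKind) (b : V) (h : G.IsEdge k (p.node p.length) b) : G.Path where
  length := p.length + 1
  node i := if i ≤ p.length then p.node i else b
  edge i := if i < p.length then p.edge i else k
  isEdge i hi := by
    rcases Nat.lt_succ_iff_lt_or_eq.1 hi with h' | rfl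
    · simpa [h', h'.le, Nat.succ_le_of_lt h'] using p.isEdge i h'
    · simpa using h

variable (p : G.Path) {k : EdgeKind} {b : V} (h : G.IsEdge k (p.node p.length) b)

@[simp] theorem snoc_length : (p.snoc k b h).length = p.length + 1 := rfl

theorem snoc_node {i : ℕ} (hi : i ≤ p.length) : (p.snoc k b h).node i = p.node i := if_pos hi

@[simp] theorem snoc_node_last : (p.snoc k b h).node (p.length + 1) = b := if_neg (by simp)

theorem snoc_edge {i : ℕ} (hi : i < p.length) : (p.snoc k b h).edge i = p.edge i := if_pos hi

@[simp] theorem snoc_edge_last : (p.snoc k b h).edge p.length = k := if_neg (by simp)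

end Path

/-- A walk that witnesses the failure of d-separation gives an open path. -/
theorem DOpen.exists_path {Z : Set V} {x y : V} {hd : Bool} (hxy : DOpen G.Adj Z x y hd) :
    ∃ p : G.Path, p.node 0 = x ∧ p.node p.length = y ∧
      (∀ i, i + 1 < p.length → ¬ ((p.Collider i (i + 1) ∧ p.node (i + 1) ∉ G.anc Z) ∨
        (¬ p.Collider i (i + 1) ∧ p.node (i + 1) ∈ Z))) ∧
      (∀ i, i + 1 = p.length → ((p.edge i).HeadRight ↔ hd = true)) := by
  induction hxy with
  | start hx =>
    exact ⟨⟨0, fun _ => x, fun _ => .right, fun i hi => absurd hi (Nat.not_lt_zero i)⟩, rfl, rfl,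
      fun i hi => absurd hi (Nat.not_lt_zero _), fun i hi => absurd hi (Nat.succ_ne_zero i)⟩
  | @right a b h _ ha hab ih =>
    obtain ⟨p, h0, hl, hopen, hlast⟩ := ih
    have he : G.IsEdge .right (p.node p.length) b := by rw [hl]; exact hab
    refine ⟨p.snoc .right b he, ?_, p.snoc_node_last he, ?_, ?_⟩
    · rw [p.snoc_node he (Nat.zero_le _), h0]
    · intro i hi
      rw [p.snoc_length he] at hi
      simp only [Path.Collider]
      rcases Nat.lt_succ_iff_lt_or_eq.1 hi with hi' | hi'
      · rw [p.snoc_edge he (Nat.lt_of_succ_lt hi'), p.snoc_edge he hi', p.snoc_node he hi'.le]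
        exact hopen i hi'
      · rw [hi', p.snoc_edge_last he, p.snoc_node he le_rfl, hl]
        simp [EdgeKind.HeadLeft, ha]
    · intro i hi
      obtain rfl : i = p.length := by simpa using hi
      simp [EdgeKind.HeadRight]
  | @left a b h _ h1 h2 hba ih =>
    obtain ⟨p, h0, hl, hopen, hlast⟩ := ih
    have he : G.IsEdge .left (p.node p.length) b := by rw [hl]; exact hba
    refine ⟨p.snoc .left b he, ?_, p.snoc_node_last he, ?_, ?_⟩
    · rw [p.snoc_node he (Nat.zero_le _), h0]
    · intro i hi
      rw [p.snoc_length he] at hi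
      simp only [Path.Collider]
      rcases Nat.lt_succ_iff_lt_or_eq.1 hi with hi' | hi'
      · rw [p.snoc_edge he (Nat.lt_of_succ_lt hi'), p.snoc_edge he hi', p.snoc_node he hi'.le]
        exact hopen i hi'
      -- The only new inner node is the old endpoint `a`; the flag decides whether it is a collider.
      · rw [hi', p.snoc_edge_last he, p.snoc_node he le_rfl, hl, p.snoc_edge he (by omega),
          hlast i hi']
        have hL : EdgeKind.left.HeadLeft := trivial
        cases h
        · simpa using h2
        · have h1 : a ∈ G.anc Z := h1 rfl
          simpa [hL] using h1
    · intro i hi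
      obtain rfl : i = p.length := by simpa using hi
      simp [EdgeKind.HeadRight]

theorem DSep.dClosed {X Y Z : Set V} (h : G.DSep X Y Z) : DClosed G.Adj X Y Z := by
  intro x hx y hy hd hxy
  have hxZ := hxy.start_notMem
  obtain ⟨p, rfl, rfl, hopen, -⟩ := hxy.exists_path
  rcases h p hx hy with h' | h' | ⟨i, hi, h'⟩
  · exact absurd h' hxZ
  · exact h'
  · exact absurd h' (hopen i hi)

/-- A walk from `x` to the given node that is not σ-blocked by `Z`, the last node apart.
The flag is set if the segment of the last node was entered by an edge pointing towards it. -/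
inductive SOpen (G : HEDG V) (Z : Set V) (x : V) : V → Bool → Prop
  | start : x ∉ Z → SOpen G Z x x false
  | within {a b : V} {h : Bool} : SOpen G Z x a h → G.Adj a b → b ∈ G.sc a → SOpen G Z x b h
  | cross {a b : V} {h h' : Bool} (k : EdgeKind) : SOpen G Z x a h → G.IsEdge k a b →
      b ∉ G.sc a → (k = .right → a ∉ Z) → (k = .left → b ∉ Z) →
      (k.HeadLeft → h = true → a ∈ G.anc Z) → (h' = false → ¬ k.HeadRight) → SOpen G Z x b h'

theorem SOpen.start_notMem {Z : Set V} {x y : V} {h : Bool} (hxy : SOpen G Z x y h) : x ∉ Z := by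
  induction hxy <;> assumption

/-- A directed path between two nodes of one component stays inside that component, so following it
never leaves the segment and keeps the flag. -/
theorem SOpen.of_mem_sc {Z : Set V} {x a b : V} {h : Bool} (hxa : SOpen G Z x a h)
    (hb : b ∈ G.sc a) : SOpen G Z x b h := by
  obtain ⟨hba, hab⟩ := mem_sc.1 hb
  clear hb
  induction hab using Relation.ReflTransGen.head_induction_on with
  | refl => exact hxa
  | @head a c hac hcb ih =>
    exact ih (hxa.within hac (mem_sc.2 ⟨hcb.trans hba, .single hac⟩)) (hba.tail hac)

/-- The last clause is the induction invariant: a false flag guarantees that the edge entering the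
final segment, if any, has no arrowhead there. A true flag guarantees nothing; it only strengthens
the later collider condition. -/
theorem SOpen.exists_path {Z : Set V} {x y : V} {hd : Bool} (hxy : SOpen G Z x y hd) :
    ∃ p : G.Path, p.node 0 = x ∧ p.node p.length = y ∧
      (∀ i < p.length, p.node (i + 1) ∉ G.sc (p.node i) →
        ¬ ((p.edge i = .right ∧ p.node i ∈ Z) ∨ (p.edge i = .left ∧ p.node (i + 1) ∈ Z))) ∧
      (∀ i k, p.IsInnerSegment i k → p.Collider (i - 1) k → p.node i ∈ G.anc Z) ∧
      (hd = false → ∀ i < p.length, (∀ j, i < j → j ≤ p.length → p.node j ∈ G.sc (p.node (i + 1))) →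
        p.node i ∉ G.sc (p.node (i + 1)) → ¬ (p.edge i).HeadRight) := by
  induction hxy with
  | start hx =>
    refine ⟨⟨0, fun _ => x, fun _ => .right, fun i hi => absurd hi (Nat.not_lt_zero i)⟩, rfl, rfl,
      fun i hi => absurd hi (Nat.not_lt_zero _), ?_, fun _ i hi => absurd hi (Nat.not_lt_zero i)⟩
    exact fun i k h => absurd h.2.2.1 (Nat.not_lt_zero k)
  | @within a b h _ hab hb ih =>
    obtain ⟨p, h0, hl, hedge, hseg, hlast⟩ := ih
    have he : G.IsEdge .right (p.node p.length) b := by rw [hl]; exact hab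
    refine ⟨p.snoc .right b he, ?_, p.snoc_node_last he, ?_, ?_, ?_⟩
    · rw [p.snoc_node he (Nat.zero_le _), h0]
    · intro i hi
      rcases Nat.lt_succ_iff_lt_or_eq.1 hi with hi' | rfl
      · rw [p.snoc_node he hi'.le, p.snoc_node he hi', p.snoc_edge he hi']
        exact hedge i hi'
      · rw [p.snoc_node_last he, p.snoc_node he le_rfl, hl]
        exact fun hn => absurd hb hn
    · rintro i k ⟨hi, hik, hk, hsc, hs1, hs2⟩ ⟨hc1, hc2⟩
      rw [p.snoc_length] at hk
      rcases Nat.lt_succ_iff_lt_or_eq.1 hk with hk' | rfl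
      · rw [p.snoc_node he (by omega : i ≤ p.length)] at hsc hs1 hs2 ⊢
        rw [p.snoc_node he (by omega : i - 1 ≤ p.length)] at hs1
        rw [p.snoc_node he (by omega : k + 1 ≤ p.length)] at hs2
        rw [p.snoc_edge he (by omega : i - 1 < p.length)] at hc1
        rw [p.snoc_edge he hk'] at hc2
        refine hseg i k ⟨hi, hik, hk', fun j hj hjk => ?_, hs1, hs2⟩ ⟨hc1, hc2⟩
        have := hsc j hj hjk
        rwa [p.snoc_node he (by omega : j ≤ p.length)] at this
      · rw [p.snoc_edge_last] at hc2
        exact absurd hc2 (by simp [EdgeKind.HeadLeft])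
    · intro hh i hi hsc hs
      rw [p.snoc_length] at hi
      rcases Nat.lt_succ_iff_lt_or_eq.1 hi with hi' | rfl
      · rw [p.snoc_node he hi'] at hsc hs
        rw [p.snoc_node he hi'.le] at hs
        rw [p.snoc_edge he hi']
        refine hlast hh i hi' (fun j hj hjl => ?_) hs
        have := hsc j hj (hjl.trans (Nat.le_succ _))
        rwa [p.snoc_node he hjl] at this
      · rw [p.snoc_node_last, p.snoc_node he le_rfl, hl] at hs
        exact absurd (mem_sc_symm hb) hs
  | @cross a b h h' k _ hab hb hr hlf hcol hh' ih =>
    obtain ⟨p, h0, hl, hedge, hseg, hlast⟩ := ih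
    have he : G.IsEdge k (p.node p.length) b := by rw [hl]; exact hab
    refine ⟨p.snoc k b he, ?_, p.snoc_node_last he, ?_, ?_, ?_⟩
    · rw [p.snoc_node he (Nat.zero_le _), h0]
    · intro i hi
      rcases Nat.lt_succ_iff_lt_or_eq.1 hi with hi' | rfl
      · rw [p.snoc_node he hi'.le, p.snoc_node he hi', p.snoc_edge he hi']
        exact hedge i hi'
      · rw [p.snoc_node_last he, p.snoc_node he le_rfl, hl, p.snoc_edge_last he]
        rintro - (⟨h1, h2⟩ | ⟨h1, h2⟩)
        · exact hr h1 h2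
        · exact hlf h1 h2
    · rintro i m ⟨hi, him, hm, hsc, hs1, hs2⟩ ⟨hc1, hc2⟩
      rw [p.snoc_length] at hm
      rw [p.snoc_node he (by omega : i ≤ p.length)] at hsc hs1 hs2 ⊢
      rw [p.snoc_node he (by omega : i - 1 ≤ p.length)] at hs1
      rw [p.snoc_edge he (by omega : i - 1 < p.length)] at hc1
      have hsc' : ∀ j, i ≤ j → j ≤ m → p.node j ∈ G.sc (p.node i) := by
        intro j hj hjm
        have := hsc j hj hjm
        rwa [p.snoc_node he (by omega : j ≤ p.length)] at this
      rcases Nat.lt_succ_iff_lt_or_eq.1 hm with hm' | rfl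
      · rw [p.snoc_node he (by omega : m + 1 ≤ p.length)] at hs2
        rw [p.snoc_edge he hm'] at hc2
        exact hseg i m ⟨hi, him, hm', hsc', hs1, hs2⟩ ⟨hc1, hc2⟩
      -- The crossing edge has just turned the former final segment into an inner one. It was
      -- entered with an arrowhead, so its flag is true and the collider condition at `a` applies to
      -- the whole component.
      · rw [p.snoc_edge_last] at hc2
        have hai : a ∈ G.sc (p.node i) := hl ▸ hsc' _ him le_rfl
        have hh : h = true := by
          cases h
          · have hi1 : i - 1 + 1 = i := by omega
            refine absurd hc1 (hlast rfl (i - 1) (by omega) ?_ ?_)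
            · rw [hi1]
              exact fun j hj hjl => hsc' j (by omega) hjl
            · rwa [hi1]
          · rfl
        exact mem_anc_of_mem_sc (mem_sc_symm hai) (hcol hc2 hh)
    · intro hh i hi hsc hs
      rw [p.snoc_length] at hi
      rcases Nat.lt_succ_iff_lt_or_eq.1 hi with hi' | rfl
      · have h1 := hsc p.length hi' (Nat.le_succ _)
        have h2 := hsc (p.length + 1) (by omega) le_rfl
        rw [p.snoc_node_last] at h2
        rw [p.snoc_node he le_rfl, hl] at h1
        exact absurd (mem_sc_trans (mem_sc_symm h1) h2) hb
      · rw [p.snoc_edge_last]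
        exact hh' hh

theorem SigmaSep.mem_of_sOpen {X Y Z : Set V} (hsep : G.SigmaSep X Y Z) {x y : V} (hx : x ∈ X)
    (hy : y ∈ Y) {h : Bool} (hxy : SOpen G Z x y h) : y ∈ Z := by
  have hxZ := hxy.start_notMem
  obtain ⟨p, rfl, rfl, hedge, hseg, -⟩ := hxy.exists_path
  rcases hsep p hx hy with h' | h' | ⟨i, hi, hn, h'⟩ | ⟨i, k, hs, hc, he⟩
  · exact absurd h' hxZ
  · exact h'
  · exact absurd h' (hedge i hi hn)
  · exact absurd he (Set.Nonempty.ne_empty ⟨_, self_mem_sc _, hseg i k hs hc⟩)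

/-! ### From the acyclic augmentation back to the original graph -/

section Augmentation

theorem aug_reflTransGen_inr {n : G.AugNode} {F : G.MaxH} :
    Relation.ReflTransGen G.aug.Adj n (.inr F) ↔ n = .inr F := by
  refine ⟨fun h => ?_, fun h => h ▸ .refl⟩
  rcases Relation.ReflTransGen.cases_tail h with h | ⟨c, -, h⟩
  · exact h.symm
  · cases c <;> exact h.elim

theorem aug_reflTransGen_inl {a b : V} :
    Relation.ReflTransGen G.aug.Adj (.inl a) (.inl b) ↔ Relation.ReflTransGen G.Adj a b := by
  constructor
  · intro h
    suffices ∀ n, Relation.ReflTransGen G.aug.Adj (.inl a) n →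
        ∀ c, n = .inl c → Relation.ReflTransGen G.Adj a c from this _ h b rfl
    intro n hn
    induction hn with
    | refl => rintro c ⟨⟩; exact .refl
    | @tail m n hm hmn ih =>
      rintro c rfl
      rcases m with m | F
      · exact (ih m rfl).tail hmn
      · cases aug_reflTransGen_inr.1 hm
  · intro h
    induction h with
    | refl => exact .refl
    | tail _ hbc ih => exact ih.tail hbc

theorem inl_mem_aug_sc {a b : V} : (Sum.inl b : G.AugNode) ∈ G.aug.sc (.inl a) ↔ b ∈ G.sc a := by
  rw [mem_sc, mem_sc, aug_reflTransGen_inl, aug_reflTransGen_inl]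

theorem inr_notMem_aug_sc {a : V} {F : G.MaxH} : (Sum.inr F : G.AugNode) ∉ G.aug.sc (.inl a) := by
  rw [mem_sc, aug_reflTransGen_inr]
  simp

theorem acag_adj_inl {a b : V} : G.acag.Adj (.inl a) (.inl b) ↔
    a ∉ G.sc b ∧ ∃ b' ∈ G.sc b, G.Adj a b' := by
  change Sum.inl a ∉ G.aug.sc (.inl b) ∧ (∃ b' ∈ G.aug.sc (.inl b), G.aug.Adj (.inl a) b') ↔ _
  rw [inl_mem_aug_sc]
  refine and_congr_right fun _ => ⟨?_, ?_⟩
  · rintro ⟨b' | F, hb', h⟩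
    · exact ⟨b', inl_mem_aug_sc.1 hb', h⟩
    · exact absurd hb' inr_notMem_aug_sc
  · rintro ⟨b', hb', h⟩
    exact ⟨.inl b', inl_mem_aug_sc.2 hb', h⟩

theorem acag_adj_inr_inl {F : G.MaxH} {b : V} : G.acag.Adj (.inr F) (.inl b) ↔
    ((F : Set V) ∩ G.sc b).Nonempty := by
  change Sum.inr F ∉ G.aug.sc (.inl b) ∧ (∃ b' ∈ G.aug.sc (.inl b), G.aug.Adj (.inr F) b') ↔ _
  refine ⟨?_, ?_⟩
  · rintro ⟨-, b' | F', hb', h⟩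
    · exact ⟨b', h, inl_mem_aug_sc.1 hb'⟩
    · exact absurd hb' inr_notMem_aug_sc
  · rintro ⟨b', hF, hb'⟩
    exact ⟨inr_notMem_aug_sc, .inl b', inl_mem_aug_sc.2 hb', hF⟩

theorem not_acag_adj_inr {n : G.AugNode} {F : G.MaxH} : ¬ G.acag.Adj n (.inr F) := by
  rintro ⟨-, b, hb, h⟩
  obtain rfl := aug_reflTransGen_inr.1 (mem_sc.1 hb).1
  cases n <;> exact h.elim

/-- An acyclified edge `a → b` expands to an edge into the component of `b` and a directed path
inside it. -/
theorem aug_reflTransGen_of_acag {a b : G.AugNode} (h : Relation.ReflTransGen G.acag.Adj a b) :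
    Relation.ReflTransGen G.aug.Adj a b := by
  induction h with
  | refl => exact .refl
  | tail _ hbc ih =>
    obtain ⟨-, b', hb', hadj⟩ := hbc
    exact ih.trans (.head hadj (mem_sc.1 hb').1)

theorem mem_anc_of_acag {Z : Set V} {a : V}
    (h : (Sum.inl a : G.AugNode) ∈ ancOf G.acag.Adj (Sum.inl '' Z)) : a ∈ G.anc Z := by
  obtain ⟨_, ⟨z, hz, rfl⟩, h⟩ := h
  exact ⟨z, hz, aug_reflTransGen_inl.1 (aug_reflTransGen_of_acag h)⟩

/-- What an open walk in the acyclic augmentation yields in the original graph. -/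
def SOpenAt (G : HEDG V) (Z : Set V) (x : V) (h : Bool) : G.AugNode → Prop
  | .inl a => (h = false → a ∉ Z) → ∃ h', SOpen G Z x a h' ∧ (h = false → h' = false)
  | .inr F => h = false ∧ ∃ a h', SOpen G Z x a h' ∧ (h' = true → a ∈ G.anc Z) ∧
      ((F : Set V) ∩ G.sc a).Nonempty

/-- Each acyclified edge unfolds into one crossing edge and a walk inside the component of its head.
An error node is a root outside the conditioning set, so it is only passed as `a ← F → b`; this
becomes a bidirected edge between the two components, or a walk inside one. The proviso `h = false →
a ∉ Z` is there because a crossing edge `←` needs its tail outside `Z` at once, whereas `DOpen`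
checks this only when the walk continues. -/
theorem SOpenAt.of_dOpen {Z : Set V} {x : V} {n : G.AugNode} {h : Bool}
    (hn : DOpen G.acag.Adj (Sum.inl '' Z) (.inl x) n h) : SOpenAt G Z x h n := by
  have hinl {v : V} (hv : (Sum.inl v : G.AugNode) ∉ Sum.inl '' Z) : v ∉ Z :=
    fun h => hv ⟨v, h, rfl⟩
  induction hn with
  | start hx => exact fun _ => ⟨false, .start (hinl hx), fun _ => rfl⟩
  | @right a b h _ ha hab ih =>
    rcases b with b | F
    swap
    · exact absurd hab not_acag_adj_inr
    refine fun _ => ?_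
    suffices ∃ h', SOpen G Z x b h' from this.imp fun _ h => ⟨h, fun h => by simp at h⟩
    rcases a with a | F
    · obtain ⟨h', hxa, -⟩ := ih fun _ => hinl ha
      obtain ⟨hab', b', hb', hadj⟩ := acag_adj_inl.1 hab
      refine ⟨true, SOpen.of_mem_sc (a := b') ?_ (mem_sc_symm hb')⟩
      exact hxa.cross .right hadj (fun hba => hab' (mem_sc_trans hb' (mem_sc_symm hba)))
        (fun _ => hinl ha) (fun h => by simp at h) (fun h => h.elim) (fun h => by simp at h)
    · obtain ⟨-, a, h', hxa, hanc, a', ha'F, ha'⟩ := ih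
      obtain ⟨b', hb'F, hb'⟩ := acag_adj_inr_inl.1 hab
      -- If `F` meets one component twice, no edge is crossed and the old flag survives.
      by_cases hba : b ∈ G.sc a
      · exact ⟨h', hxa.of_mem_sc hba⟩
      have hne : b' ∉ G.sc a' := fun hc =>
        hba (mem_sc_trans (mem_sc_trans ha' hc) (mem_sc_symm hb'))
      refine ⟨true, SOpen.of_mem_sc (a := b') ?_ (mem_sc_symm hb')⟩
      refine (hxa.of_mem_sc ha').cross .bi ⟨?_, ?_⟩ hne (fun h => by simp at h)
        (fun h => by simp at h) (fun _ h => mem_anc_of_mem_sc ha' (hanc h)) (fun h => by simp at h)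
      · rintro rfl
        exact hne (self_mem_sc _)
      · exact G.down_closed F F.2.prop _ (Set.pair_subset ha'F hb'F)
  | @left a b h _ h1 h2 hba ih =>
    rcases a with a | F
    swap
    · exact absurd hba not_acag_adj_inr
    obtain ⟨h', hxa, hh'⟩ := ih fun h => hinl (h2 h)
    have hanc : h' = true → a ∈ G.anc Z := by
      rintro rfl
      refine mem_anc_of_acag (h1 ?_)
      cases h
      · exact absurd (hh' rfl) (by simp)
      · rfl
    rcases b with b | F
    · intro hbZ
      obtain ⟨hab', a', ha', hadj⟩ := acag_adj_inl.1 hba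
      refine ⟨false, ?_, fun _ => rfl⟩
      exact (hxa.of_mem_sc ha').cross .left hadj (fun hc => hab' (mem_sc_trans ha' hc))
        (fun h => by simp at h) (fun _ => hbZ rfl) (fun _ h => mem_anc_of_mem_sc ha' (hanc h))
        (fun _ h => h)
    · exact ⟨rfl, a, h', hxa, hanc, acag_adj_inr_inl.1 hba⟩

/-- σ-separation in a graph implies d-separation in its acyclic augmentation. -/
theorem SigmaSep.dClosed_acag {X Y Z : Set V} (hsep : G.SigmaSep X Y Z) :
    DClosed G.acag.Adj (Sum.inl '' X) (Sum.inl '' Y) (Sum.inl '' Z) := by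
  rintro _ ⟨x, hx, rfl⟩ _ ⟨y, hy, rfl⟩ h hxy
  by_contra hyZ
  have hyZ' : y ∉ Z := fun h => hyZ ⟨y, h, rfl⟩
  obtain ⟨h', hs, -⟩ := SOpenAt.of_dOpen hxy fun _ => hyZ'
  exact hyZ' (hsep.mem_of_sOpen hx hy hs)

end Augmentation

end HEDG

/-! ### Conditional independence of coordinates -/

namespace HEDG

section Coordinates

variable {W : Type v} {𝒳 : W → Type u} [∀ a, MeasurableSpace (𝒳 a)]

/-- The events that are determined by the coordinates in `A`. -/
@[reducible]
def coordAlg (𝒳 : W → Type u) [∀ a, MeasurableSpace (𝒳 a)] (A : Set W) :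
    MeasurableSpace (∀ a, 𝒳 a) :=
  MeasurableSpace.comap (coord A) inferInstance

theorem coordAlg_eq_iSup (A : Set W) :
    coordAlg 𝒳 A = ⨆ a : A, MeasurableSpace.comap (fun x : ∀ a, 𝒳 a => x a) inferInstance := by
  simp only [coordAlg, MeasurableSpace.pi, MeasurableSpace.comap_iSup,
    MeasurableSpace.comap_comp]
  rfl

theorem coordAlg_le (A : Set W) : coordAlg 𝒳 A ≤ MeasurableSpace.pi :=
  (measurable_coord A).comap_le

theorem comap_eval_le_coordAlg {A : Set W} {a : W} (ha : a ∈ A) :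
    MeasurableSpace.comap (fun x : ∀ a, 𝒳 a => x a) inferInstance ≤ coordAlg 𝒳 A := by
  rw [coordAlg_eq_iSup]
  exact le_iSup (fun a : A => MeasurableSpace.comap (fun x : ∀ a, 𝒳 a => x a) inferInstance)
    ⟨a, ha⟩

theorem measurable_eval_coordAlg {A : Set W} {a : W} (ha : a ∈ A) :
    Measurable[coordAlg 𝒳 A] fun x : ∀ a, 𝒳 a => x a :=
  measurable_iff_comap_le.2 (comap_eval_le_coordAlg ha)

theorem coordAlg_le_iff {A : Set W} {m : MeasurableSpace (∀ a, 𝒳 a)} : coordAlg 𝒳 A ≤ m ↔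
    ∀ a ∈ A, MeasurableSpace.comap (fun x : ∀ a, 𝒳 a => x a) inferInstance ≤ m := by
  rw [coordAlg_eq_iSup, iSup_le_iff, Subtype.forall]

theorem coordAlg_mono {A B : Set W} (h : A ⊆ B) : coordAlg 𝒳 A ≤ coordAlg 𝒳 B :=
  coordAlg_le_iff.2 fun _ ha => comap_eval_le_coordAlg (h ha)

theorem coordAlg_union (A B : Set W) : coordAlg 𝒳 (A ∪ B) = coordAlg 𝒳 A ⊔ coordAlg 𝒳 B := by
  refine le_antisymm (coordAlg_le_iff.2 ?_)
    (sup_le (coordAlg_mono Set.subset_union_left) (coordAlg_mono Set.subset_union_right))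
  rintro a (ha | ha)
  · exact (comap_eval_le_coordAlg ha).trans le_sup_left
  · exact (comap_eval_le_coordAlg ha).trans le_sup_right

theorem coordAlg_empty : coordAlg 𝒳 ∅ = ⊥ :=
  le_bot_iff.1 (coordAlg_le_iff.2 fun _ ha => ha.elim)

theorem coordAlg_singleton (a : W) : coordAlg 𝒳 {a} =
    MeasurableSpace.comap (fun x : ∀ a, 𝒳 a => x a) inferInstance :=
  le_antisymm (coordAlg_le_iff.2 fun _ ha => by cases ha; exact le_rfl)
    (comap_eval_le_coordAlg rfl)

variable [Finite W] [∀ a, StandardBorelSpace (𝒳 a)]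

theorem coordCondIndep_iff (Q : Measure (∀ a, 𝒳 a)) [IsFiniteMeasure Q] (X Y Z : Set W) :
    CoordCondIndep Q X Y Z ↔ CondProbEq (coordAlg 𝒳 X) (coordAlg 𝒳 Y) (coordAlg 𝒳 Z) Q := by
  rw [CoordCondIndep, condIndepFun_iff_condIndep]
  exact condIndep_iff_condProbEq (coordAlg_le X) (coordAlg_le Y)

theorem semigraphoid_coordCondIndep (Q : Measure (∀ a, 𝒳 a)) [IsFiniteMeasure Q] :
    Semigraphoid (CoordCondIndep Q) where
  refl X Z := (coordCondIndep_iff Q X Z Z).2 (condProbEq_self _ _)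
  symm h := CondIndepFun.symm h
  mono h hY := by
    rw [coordCondIndep_iff] at h ⊢
    exact h.mono_right (coordAlg_le _) (coordAlg_le _) (coordAlg_mono hY)
  weakUnion h hU := by
    rw [coordCondIndep_iff] at h ⊢
    rw [coordAlg_union]
    exact h.weakUnion (coordAlg_le _) (coordAlg_le _) (coordAlg_mono hU)
  contraction h h' := by
    rw [coordCondIndep_iff] at h h' ⊢
    rw [coordAlg_union] at h' ⊢
    exact h.contraction h'

/-- A variable that is almost surely a function of the variables in `Z` is conditionally
independent of all variables given those in `Z`. -/
theorem coordCondIndep_of_ae_eq (Q : Measure (∀ a, 𝒳 a)) [IsFiniteMeasure Q] {s : W}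
    {Y Z : Set W} {g : (∀ a, 𝒳 a) → 𝒳 s} (hg : Measurable[coordAlg 𝒳 Z] g)
    (h : ∀ᵐ x ∂Q, x s = g x) : CoordCondIndep Q {s} Y Z := by
  rw [coordCondIndep_iff, coordAlg_singleton]
  refine condProbEq_of_ae_eq (coordAlg_le _) (coordAlg_le _) ?_
  rintro _ ⟨t, ht, rfl⟩
  refine ⟨g ⁻¹' t, hg ht, ?_⟩
  filter_upwards [h] with x hx
  exact congrArg t hx

end Coordinates

/-! ### The Markov property of the structural equations -/

section Model

variable {V : Type v} {G : HEDG V} {𝒳 : V → Type u} [∀ a, MeasurableSpace (𝒳 a)]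
  {ℰ : G.MaxH → Type u} [∀ F, MeasurableSpace (ℰ F)] {Ω : Type w} [MeasurableSpace Ω]
  {E : ∀ F, Ω → ℰ F} {X : ∀ a, Ω → 𝒳 a}

theorem measurable_jointVar (hE : ∀ F, Measurable (E F)) (hX : ∀ a, Measurable (X a)) :
    Measurable (jointVar X E) :=
  measurable_pi_lambda _ fun b => match b with
    | .inl a => hX a
    | .inr F => hE F

theorem measurable_projV :
    Measurable (projV : (∀ b : G.AugNode, AugSpace 𝒳 ℰ b) → ∀ a, 𝒳 a) :=
  measurable_pi_lambda _ fun a => measurable_pi_apply (Sum.inl a : G.AugNode)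

theorem comap_projV_coordAlg (A : Set V) :
    (coordAlg 𝒳 A).comap (projV : (∀ b : G.AugNode, AugSpace 𝒳 ℰ b) → ∀ a, 𝒳 a) =
      coordAlg (AugSpace 𝒳 ℰ) (Sum.inl '' A) := by
  apply le_antisymm
  · rw [coordAlg_eq_iSup, MeasurableSpace.comap_iSup]
    refine iSup_le fun a => ?_
    rw [MeasurableSpace.comap_comp]
    exact comap_eval_le_coordAlg (𝒳 := AugSpace 𝒳 ℰ) (a := Sum.inl (a : V)) ⟨a, a.2, rfl⟩
  · rw [coordAlg_le_iff]
    rintro _ ⟨a, ha, rfl⟩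
    refine le_trans ?_ (MeasurableSpace.comap_mono (comap_eval_le_coordAlg ha))
    rw [MeasurableSpace.comap_comp]
    exact le_rfl

theorem CoordCondIndep.map_projV [Finite V] [∀ a, StandardBorelSpace (𝒳 a)]
    [∀ F, StandardBorelSpace (ℰ F)] {Q : Measure (∀ b : G.AugNode, AugSpace 𝒳 ℰ b)}
    [IsFiniteMeasure Q] {X Y Z : Set V}
    (h : CoordCondIndep Q (Sum.inl '' X) (Sum.inl '' Y) (Sum.inl '' Z)) :
    CoordCondIndep (Q.map projV) X Y Z := by
  rw [coordCondIndep_iff] at h ⊢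
  refine CondProbEq.map measurable_projV (coordAlg_le _) (coordAlg_le _) (coordAlg_le _) ?_
  simpa only [comap_projV_coordAlg] using h

/-- Disjoint families of error terms are independent under the joint law. -/
theorem indep_coordAlg_inr {Pr : Measure Ω} (hE : ∀ F, Measurable (E F))
    (hX : ∀ a, Measurable (X a)) (hind : iIndepFun E Pr) {S T : Set G.MaxH} (hST : Disjoint S T) :
    Indep (coordAlg (AugSpace 𝒳 ℰ) (Sum.inr '' S)) (coordAlg (AugSpace 𝒳 ℰ) (Sum.inr '' T))
      (Pr.map (jointVar X E)) := by
  have hJ := measurable_jointVar hE hX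
  have hle (S : Set G.MaxH) : (coordAlg (AugSpace 𝒳 ℰ) (Sum.inr '' S)).comap (jointVar X E) ≤
      ⨆ F ∈ S, MeasurableSpace.comap (E F) inferInstance := by
    rw [coordAlg_eq_iSup, MeasurableSpace.comap_iSup]
    refine iSup_le ?_
    rintro ⟨_, F, hF, rfl⟩
    rw [MeasurableSpace.comap_comp]
    exact le_iSup₂ (f := fun F (_ : F ∈ S) => MeasurableSpace.comap (E F) inferInstance) F hF
  have h := indep_iSup_of_disjoint (fun F => (hE F).comap_le) hind.iIndep hST
  rw [Indep_iff] at h ⊢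
  intro s t hs ht
  have hs' := coordAlg_le _ _ hs
  have ht' := coordAlg_le _ _ ht
  rw [Measure.map_apply hJ (hs'.inter ht'), Measure.map_apply hJ hs', Measure.map_apply hJ ht',
    Set.preimage_inter]
  exact h _ _ (hle S _ ⟨s, hs, rfl⟩) (hle T _ ⟨t, ht, rfl⟩)

theorem IsCsSEP.map_projV {P : Measure (∀ a, 𝒳 a)} {Pr : Measure Ω}
    (h : IsCsSEP G P Pr E X) :
    (Pr.map (jointVar X E)).map projV = P := by
  rw [Measure.map_map measurable_projV (measurable_jointVar h.measurable_E h.measurable_X)]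
  exact h.law

theorem IsCsSEP.isProbabilityMeasure {P : Measure (∀ a, 𝒳 a)} {Pr : Measure Ω}
    [IsProbabilityMeasure Pr] (h : IsCsSEP G P Pr E X) :
    IsProbabilityMeasure (Pr.map (jointVar X E)) :=
  Measure.isProbabilityMeasure_map
    (measurable_jointVar h.measurable_E h.measurable_X).aemeasurable

variable [Finite V] [∀ a, StandardBorelSpace (𝒳 a)] [∀ F, StandardBorelSpace (ℰ F)]
  {P : Measure (∀ a, 𝒳 a)} {Pr : Measure Ω} [IsProbabilityMeasure Pr]

theorem IsCsSEP.coordCondIndep_inl (h : IsCsSEP G P Pr E X)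
    [IsProbabilityMeasure (Pr.map (jointVar X E))] (a : V) (Y : Set G.AugNode) :
    CoordCondIndep (Pr.map (jointVar X E)) {.inl a} Y {b | G.acag.Adj b (.inl a)} := by
  obtain ⟨g, hg, hXg⟩ := h.component a
  have hJ := measurable_jointVar h.measurable_E h.measurable_X
  let φ : (∀ b : G.AugNode, AugSpace 𝒳 ℰ b) → (∀ b : (G.pa (G.sc a) \ G.sc a : Set V), 𝒳 b) ×
      (∀ F : G.MaxHAt (G.sc a), ℰ F) :=
    fun x => (fun b => x (.inl (b : V)), fun F => x (.inr (F : G.MaxH)))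
  have hφ : Measurable[coordAlg (AugSpace 𝒳 ℰ) {b | G.acag.Adj b (.inl a)}] φ := by
    refine Measurable.prodMk
      (@measurable_pi_lambda _ _ _ (coordAlg (AugSpace 𝒳 ℰ) _) _ _ fun b => ?_)
      (@measurable_pi_lambda _ _ _ (coordAlg (AugSpace 𝒳 ℰ) _) _ _ fun F => ?_)
    · exact measurable_eval_coordAlg (𝒳 := AugSpace 𝒳 ℰ) (a := Sum.inl (b : V))
        (acag_adj_inl.2 ⟨b.2.2, b.2.1⟩)
    · exact measurable_eval_coordAlg (𝒳 := AugSpace 𝒳 ℰ) (a := Sum.inr (F : G.MaxH))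
        (acag_adj_inr_inl.2 F.2)
  have hgφ : Measurable[coordAlg (AugSpace 𝒳 ℰ) {b | G.acag.Adj b (.inl a)}] (g ∘ φ) :=
    hg.comp hφ
  refine coordCondIndep_of_ae_eq _ (s := Sum.inl a) (g := g ∘ φ) hgφ ?_
  refine (ae_map_iff hJ.aemeasurable (measurableSet_eq_fun
    (measurable_pi_apply (X := AugSpace 𝒳 ℰ) (Sum.inl a : G.AugNode))
    (hgφ.mono (coordAlg_le _) le_rfl))).2 ?_
  exact hXg

/-- Only a suitable sink has to be found in each nonempty ancestral set: an observed node if there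
is one, and otherwise any error node, which has no parents and is independent of the other error
terms. -/
theorem IsCsSEP.coordCondIndep_of_dClosed (h : IsCsSEP G P Pr E X)
    [IsProbabilityMeasure (Pr.map (jointVar X E))] {A B C : Set G.AugNode}
    (hsep : DClosed G.acag.Adj A B C) : CoordCondIndep (Pr.map (jointVar X E)) A B C := by
  refine (semigraphoid_coordCondIndep _).of_dClosed (fun A hA _ => ?_) hsep
  by_cases hne : ∃ a, Sum.inl a ∈ A
  -- A minimal `a` reaches no observed node of `A` outside its own component, whereas edges of the
  -- acyclic augmentation always leave a component; hence `a` is a sink.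
  · let below (a b : V) : Prop :=
      Relation.ReflTransGen G.Adj b a ∧ ¬ Relation.ReflTransGen G.Adj a b
    have : IsTrans V below :=
      ⟨fun a b c hab hbc => ⟨hbc.1.trans hab.1, fun hac => hab.2 (hac.trans hbc.1)⟩⟩
    have : Std.Irrefl below := ⟨fun a ha => ha.2 .refl⟩
    obtain ⟨a, haA, hmin⟩ :=
      (Finite.wellFounded_of_trans_of_irrefl below).has_min {a | Sum.inl a ∈ A} hne
    refine ⟨.inl a, haA, ?_, h.coordCondIndep_inl a _⟩
    rintro (b | F) hb hab
    · obtain ⟨hsc, b', hb', hadj⟩ := acag_adj_inl.1 hab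
      have hr : Relation.ReflTransGen G.Adj a b := .head hadj (mem_sc.1 hb').1
      exact hmin b hb ⟨hr, fun hba => hsc (mem_sc.2 ⟨hr, hba⟩)⟩
    · exact not_acag_adj_inr hab
  · have hinr : ∀ b ∈ A, ∃ F, b = Sum.inr F := by
      rintro (a | F) hb
      · exact absurd ⟨a, hb⟩ hne
      · exact ⟨F, rfl⟩
    obtain ⟨s, hs⟩ := hA
    obtain ⟨F, rfl⟩ := hinr s hs
    refine ⟨.inr F, hs, ?_, ?_⟩
    · intro b hb hab
      obtain ⟨F', rfl⟩ := hinr b hb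
      exact not_acag_adj_inr hab
    · have e1 : {b | G.acag.Adj b (.inr F)} = ∅ :=
        Set.eq_empty_of_forall_notMem fun _ hb => not_acag_adj_inr hb
      have e2 : A \ {Sum.inr F} = Sum.inr '' {F' | Sum.inr F' ∈ A \ {Sum.inr F}} := by
        ext b
        constructor
        · intro hb
          obtain ⟨F', rfl⟩ := hinr b hb.1
          exact ⟨F', hb, rfl⟩
        · rintro ⟨F', hF', rfl⟩
          exact hF'
      rw [e1, e2, coordCondIndep_iff, coordAlg_empty, ← Set.image_singleton]
      refine Indep.condProbEq_bot (coordAlg_le _) (coordAlg_le _)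
        (indep_coordAlg_inr h.measurable_E h.measurable_X h.indep_E ?_)
      rw [Set.disjoint_singleton_left]
      exact fun hF => hF.2 ⟨F, rfl, rfl⟩

end Model

end HEDG

theorem mainTheorem1 {V : Type v} [Finite V] (G : HEDG V) {𝒳 : V → Type u}
    [∀ a, MeasurableSpace (𝒳 a)] [∀ a, StandardBorelSpace (𝒳 a)]
    (P : Measure (∀ a, 𝒳 a)) [IsProbabilityMeasure P] :
    (HEDG.CsSEP.{u, v, w} G P → HEDG.SmgdGMP G P) ∧
    (∀ (Ω : Type w) [MeasurableSpace Ω] (Pr : Measure Ω) [IsProbabilityMeasure Pr]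
      (ℰ : G.MaxH → Type u) [∀ F, MeasurableSpace (ℰ F)] [∀ F, StandardBorelSpace (ℰ F)]
      (E : ∀ F, Ω → ℰ F) (X : ∀ a, Ω → 𝒳 a), HEDG.IsCsSEP G P Pr E X →
      (Pr.map (HEDG.jointVar X E)).map HEDG.projV = P ∧
        HEDG.DGMP G.acag (Pr.map (HEDG.jointVar X E))) ∧
    (HEDG.CsSEP.{u, v, w} G P → HEDG.GdGMP G P) := by
  refine ⟨?_, ?_, ?_⟩
  · rintro ⟨Ω, _, Pr, _, ℰ, _, _, E, X, h⟩
    have := h.isProbabilityMeasure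
    exact ⟨ℰ, inferInstance, inferInstance, Pr.map (HEDG.jointVar X E), this, h.map_projV,
      fun _ _ _ hsep => h.coordCondIndep_of_dClosed hsep.dClosed⟩
  · intro Ω _ Pr _ ℰ _ _ E X h
    have := h.isProbabilityMeasure
    exact ⟨h.map_projV, fun _ _ _ hsep => h.coordCondIndep_of_dClosed hsep.dClosed⟩
  · rintro ⟨Ω, _, Pr, _, ℰ, _, _, E, X, h⟩ A B C hsep
    have := h.isProbabilityMeasure
    have hind := (h.coordCondIndep_of_dClosed hsep.dClosed_acag).map_projV
    simpa only [h.map_projV] using hind
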